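/- \textbf{Theorem (Consistent active variable selection for the Adaptive Transfer Lasso).} Fix $p$, $\beta^*\in\mathbb{R}^p$, $\sigma\ge 0$ and $\gamma_1,\gamma_2\ge 0$, and let $S:=\{j:\beta^*_j\ne 0\}$. For each $n$ let $X=X_n\in\mathbb{R}^{n\times p}$ be a deterministic matrix with rows $x_1,\dots,x_n$, and let $y=X\beta^*+\varepsilon$, where $\varepsilon_1,\dots,\varepsilon_n$ are i.i.d. $\mathcal N(0,\sigma^2)$. Suppose that, as $n\to\infty$, $\frac1n X^\top X\to C$ with $C$ positive definite and $\frac1n\max_i\|x_i\|_2^2\to 0$. Let $m=m_n$ be integers, positive for all large $n$, with $n/m\to r_0$ for some $r_0\in[0,\infty)$. Let $\tilde\beta=\tilde\beta_n$ be a random vector in $\mathbb{R}^p$, independent of $\varepsilon$, such that $\sqrt m(\tilde\beta-\beta^*)$ converges in distribution to some probability law on $\mathbb{R}^p$. Let $\lambda_n,\eta_n\ge 0$ be deterministic, and let the estimator $\hat\beta_n$ be a random vector which is almost surely a minimizer over $\beta\in\mathbb{R}^p$ of \[ \frac1n\|y-X\beta\|_2^2+\frac{\lambda_n}{n}\sum_{j=1}^p\frac{|\beta_j|}{|\tilde\beta_j|^{\gamma_1}}+\frac{\eta_n}{n}\sum_{j=1}^p|\tilde\beta_j|^{\gamma_2}\,|\beta_j-\tilde\beta_j|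 , \] with the conventions $0^0=1$, $1/0=\infty$ and $0\cdot\infty=0$. Assume that one of the following holds as $n\to\infty$: (ii) $\sqrt{m^{\gamma_1}/n}\,\lambda_n\to\infty$, $\eta_n/\sqrt n\to\infty$, $\eta_n/\lambda_n\to\infty$ and $\eta_n/(\sqrt{m^{\gamma_1+\gamma_2}}\,\lambda_n)\to 0$; (v) $\sqrt{m^{\gamma_1}/n}\,\lambda_n\to\infty$, $\lambda_n/\sqrt n\to\lambda_0$ and $\eta_n/\sqrt n\to\eta_0$ for some $\lambda_0,\eta_0\in[0,\infty)$; (vi) $\gamma_1>0$, $\lambda_n/\sqrt n\to\infty$, $\lambda_n/n\to 0$ and $\eta_n/\lambda_n\to 0$. Then the true support is recovered with probability tending to one: \[ P\bigl(\{j:\hat\beta_{n,j}\ne 0\}=S\bigr)\to 1\qquad(n\to\infty). \] -/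

import Mathlib

open MeasureTheory ProbabilityTheory Filter Topology
open scoped NNReal ENNReal Matrix

namespace AdaptiveTransferLasso

/-- The weight `v_j = 1 / |β̃_j| ^ γ₁`, with values in `[0, ∞]`.  It is `∞` when `β̃_j = 0` and
`γ₁ > 0` (an infinite penalty on `β_j ≠ 0`), and it is `1` when `γ₁ = 0`. -/
noncomputable def lassoWeight (γ₁ : ℝ) (b : ℝ) : ℝ≥0∞ :=
  (ENNReal.ofReal |b| ^ γ₁)⁻¹

/-- The weight `w_j = |β̃_j| ^ γ₂` (equal to `1` when `γ₂ = 0`). -/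
noncomputable def transferWeight (γ₂ : ℝ) (b : ℝ) : ℝ≥0∞ :=
  ENNReal.ofReal |b| ^ γ₂

/-- The objective function, with values in `[0, ∞]`:
`(1/n) ‖y - X β‖₂² + (lam/n) ∑ⱼ v_j |β_j| + (eta/n) ∑ⱼ w_j |β_j - β̃_j|`.
Here `0 * ∞ = 0`, so an infinite weight `v_j` costs nothing exactly when `β_j = 0`
(provided `lam > 0`). -/
noncomputable def objective {n p : ℕ} (X : Matrix (Fin n) (Fin p) ℝ) (y : Fin n → ℝ)
    (lam eta γ₁ γ₂ : ℝ) (init : Fin p → ℝ) (β : Fin p → ℝ) : ℝ≥0∞ :=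
  ENNReal.ofReal ((1 / (n : ℝ)) * ∑ i, (y i - (X *ᵥ β) i) ^ 2)
    + ENNReal.ofReal (lam / n) * ∑ j, lassoWeight γ₁ (init j) * ENNReal.ofReal |β j|
    + ENNReal.ofReal (eta / n) * ∑ j, transferWeight γ₂ (init j) * ENNReal.ofReal |β j - init j|

/-- `β` is an Adaptive Transfer Lasso estimate: a global minimiser of the objective. -/
def IsEstimate {n p : ℕ} (X : Matrix (Fin n) (Fin p) ℝ) (y : Fin n → ℝ)
    (lam eta γ₁ γ₂ : ℝ) (init : Fin p → ℝ) (β : Fin p → ℝ) : Prop :=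
  IsMinOn (objective X y lam eta γ₁ γ₂ init) Set.univ β

/-- `√(m^γ₁ / n) λ_n → ∞`, `η_n / √n → ∞`, `η_n / λ_n → ∞` and
`η_n / (√(m^(γ₁+γ₂)) λ_n) → 0`. -/
def RootMRegime (m : ℕ → ℕ) (lam eta : ℕ → ℝ) (γ₁ γ₂ : ℝ) : Prop :=
  Tendsto (fun n : ℕ => √((m n : ℝ) ^ γ₁ / n) * lam n) atTop atTop ∧
  Tendsto (fun n : ℕ => eta n / √(n : ℝ)) atTop atTop ∧
  Tendsto (fun n : ℕ => eta n / lam n) atTop atTop ∧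
  Tendsto (fun n : ℕ => eta n / (√((m n : ℝ) ^ (γ₁ + γ₂)) * lam n)) atTop (𝓝 0)

/-- `√(m^γ₁ / n) λ_n → ∞`, `λ_n / √n → λ₀ ≥ 0` and `η_n / √n → η₀ ≥ 0`. -/
def RootNRegime (m : ℕ → ℕ) (lam eta : ℕ → ℝ) (γ₁ : ℝ) : Prop :=
  Tendsto (fun n : ℕ => √((m n : ℝ) ^ γ₁ / n) * lam n) atTop atTop ∧
  (∃ lam₀ : ℝ, 0 ≤ lam₀ ∧ Tendsto (fun n : ℕ => lam n / √(n : ℝ)) atTop (𝓝 lam₀)) ∧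
  (∃ eta₀ : ℝ, 0 ≤ eta₀ ∧ Tendsto (fun n : ℕ => eta n / √(n : ℝ)) atTop (𝓝 eta₀))

/-- `λ_n / √n → ∞`, `λ_n / n → 0` and `λ_n / η_n → ∞`.  The last condition is written as
`η_n / λ_n → 0`, so that `η_n = 0` is allowed. -/
def SubRootNRegime (lam eta : ℕ → ℝ) : Prop :=
  Tendsto (fun n : ℕ => lam n / √(n : ℝ)) atTop atTop ∧
  Tendsto (fun n : ℕ => lam n / (n : ℝ)) atTop (𝓝 0) ∧
  Tendsto (fun n : ℕ => eta n / lam n) atTop (𝓝 0)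

/-- Consistent active variable selection: `P(Ŝ_n = S) → 1`. -/
def ConsistentActiveSelection {Ω : Type*} [MeasurableSpace Ω] (μ : Measure Ω) {p : ℕ}
    (est : ℕ → Ω → Fin p → ℝ) (βstar : Fin p → ℝ) : Prop :=
  Tendsto (fun n => μ {ω | Function.support (est n ω) = Function.support βstar}) atTop (𝓝 1)

end AdaptiveTransferLasso

/-!
Comparing the minimiser `β̂` with any vector `b` of finite objective yields the basic inequality:
the increase in penalty from `b` to `β̂` is at most `2 ‖Xᵀ (y - X b)‖_∞ ‖β̂ - b‖₁`. So if the
penalty has a kink at `b` that is steeper than the score, then `β̂ = b`.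

Apply this to a `b` supported on `S`. Off `S` the initial estimate is of order `1 / √m`, so the
lasso term has slope of order `λ m ^ (γ₁ / 2)` at zero, which dominates both the score and the
transfer penalty. On `S` take `b = β̃` in regime (ii): there the transfer penalty has a kink of
slope of order `η`, which dominates `√n` and `λ`. In regimes (v) and (vi) take `b = β̂` on `S`, so
that no kink is needed; the score at this `b` is controlled because the basic inequality at
`b = β*` gives `β̂ - β* = O((√n + λ + η) / n)`.

All this is deterministic once `√m (β̃ - β*)` and `Xᵀ ε / √n` are bounded. They are bounded in
probability, the first because it converges in distribution, the second by Chebyshev's inequality.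
-/

open Asymptotics

namespace AdaptiveTransferLasso

section LeastSquares

variable {ι κ : Type*} [Fintype ι] [Fintype κ]

/-- Minus half the gradient at `b` of the residual sum of squares `‖y - X b‖₂²`. -/
def score (X : Matrix ι κ ℝ) (y : ι → ℝ) (b : κ → ℝ) : κ → ℝ :=
  Xᵀ *ᵥ (y - X *ᵥ b)

lemma score_mulVec_add (X : Matrix ι κ ℝ) (βstar b : κ → ℝ) (e : ι → ℝ) :
    score X (X *ᵥ βstar + e) b = Xᵀ *ᵥ e - (Xᵀ * X) *ᵥ (b - βstar) := by
  rw [score, ← Matrix.mulVec_mulVec, ← Matrix.mulVec_sub, Matrix.mulVec_sub X]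
  congr 1
  abel

lemma score_mulVec_add_self (X : Matrix ι κ ℝ) (βstar : κ → ℝ) (e : ι → ℝ) :
    score X (X *ᵥ βstar + e) βstar = Xᵀ *ᵥ e := by
  rw [score, add_sub_cancel_left]

lemma norm_score_mulVec_add_le {X : Matrix ι κ ℝ} {a : ℝ}
    (hX : ∀ u, ‖(Xᵀ * X) *ᵥ u‖ ≤ a * ‖u‖) (βstar b : κ → ℝ) (e : ι → ℝ) :
    ‖score X (X *ᵥ βstar + e) b‖ ≤ ‖Xᵀ *ᵥ e‖ + a * ‖b - βstar‖ := by
  rw [score_mulVec_add]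
  exact (norm_sub_le _ _).trans (add_le_add_right (hX _) _)

lemma sum_sq_residual_sub (X : Matrix ι κ ℝ) (y : ι → ℝ) (β b : κ → ℝ) :
    ∑ i, (y i - (X *ᵥ β) i) ^ 2 - ∑ i, (y i - (X *ᵥ b) i) ^ 2
      = (β - b) ⬝ᵥ ((Xᵀ * X) *ᵥ (β - b)) - 2 * ((β - b) ⬝ᵥ score X y b) := by
  rw [score, ← Matrix.mulVec_mulVec, Matrix.dotProduct_transpose_mulVec,
    Matrix.dotProduct_transpose_mulVec]
  simp only [Matrix.mulVec_sub, dotProduct, ← Finset.sum_sub_distrib, Finset.mul_sum]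
  refine Finset.sum_congr rfl fun i _ => ?_
  simp only [Pi.sub_apply]
  ring

lemma dotProduct_gram_mulVec_nonneg (X : Matrix ι κ ℝ) (u : κ → ℝ) :
    0 ≤ u ⬝ᵥ ((Xᵀ * X) *ᵥ u) := by
  simpa using (Matrix.posSemidef_conjTranspose_mul_self X).dotProduct_mulVec_nonneg u

lemma dotProduct_le_norm_mul_sum_abs (u s : κ → ℝ) : u ⬝ᵥ s ≤ ‖s‖ * ∑ j, |u j| := by
  rw [Finset.mul_sum]
  refine Finset.sum_le_sum fun j _ => (le_abs_self _).trans ?_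
  rw [abs_mul, mul_comm]
  exact mul_le_mul_of_nonneg_right (norm_le_pi_norm s j) (abs_nonneg _)

lemma norm_indicator_support_sub_le (f g : κ → ℝ) :
    ‖(Function.support f).indicator g - f‖ ≤ ‖g - f‖ := by
  refine (pi_norm_le_iff_of_nonneg (norm_nonneg _)).2 fun j => ?_
  by_cases hj : f j = 0
  · simp [hj]
  · simpa [hj] using norm_le_pi_norm (g - f) j

end LeastSquares

section Penalty

variable {lam eta γ₁ γ₂ x : ℝ}

/-- The penalty, multiplied by `n`, on the value `t` of a coefficient whose source estimate is `x`.
Where `lassoWeight γ₁ x = ∞`, its first summand has the junk value `0`. -/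
noncomputable def penalty (lam eta γ₁ γ₂ x t : ℝ) : ℝ :=
  lam * ((|x| ^ γ₁)⁻¹ * |t|) + eta * (|x| ^ γ₂ * |t - x|)

lemma penalty_nonneg (hlam : 0 ≤ lam) (heta : 0 ≤ eta) (t : ℝ) :
    0 ≤ penalty lam eta γ₁ γ₂ x t := by
  unfold penalty
  positivity

lemma penalty_sub_penalty_zero_ge (heta : 0 ≤ eta) (t : ℝ) :
    (lam * (|x| ^ γ₁)⁻¹ - eta * |x| ^ γ₂) * |t|
      ≤ penalty lam eta γ₁ γ₂ x t - penalty lam eta γ₁ γ₂ x 0 := by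
  have triangle : 0 ≤ |t| + |t - x| - |0 - x| := by
    have h := abs_sub_le 0 t x
    rw [zero_sub t, abs_neg] at h
    linarith
  have weighted := mul_nonneg (mul_nonneg heta (Real.rpow_nonneg (abs_nonneg x) γ₂)) triangle
  simp only [penalty, abs_zero]
  linarith

lemma penalty_sub_penalty_self_ge (hlam : 0 ≤ lam) (t : ℝ) :
    (eta * |x| ^ γ₂ - lam * (|x| ^ γ₁)⁻¹) * |t - x|
      ≤ penalty lam eta γ₁ γ₂ x t - penalty lam eta γ₁ γ₂ x x := by
  have triangle : 0 ≤ |t - x| + |t| - |x| := by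
    linarith [abs_sub_abs_le_abs_sub x t, abs_sub_comm x t]
  have weighted := mul_nonneg
    (mul_nonneg hlam (inv_nonneg.2 (Real.rpow_nonneg (abs_nonneg x) γ₁))) triangle
  simp only [penalty, sub_self, abs_zero]
  linarith

lemma neg_le_penalty_sub_penalty (hlam : 0 ≤ lam) (heta : 0 ≤ eta) (t b : ℝ) :
    -((lam * (|x| ^ γ₁)⁻¹ + eta * |x| ^ γ₂) * |t - b|)
      ≤ penalty lam eta γ₁ γ₂ x t - penalty lam eta γ₁ γ₂ x b := by
  have triangle_lasso : 0 ≤ |t - b| + |t| - |b| := by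
    linarith [abs_sub_abs_le_abs_sub b t, abs_sub_comm b t]
  have triangle_transfer : 0 ≤ |t - b| + |t - x| - |b - x| := by
    linarith [abs_sub_le b t x, abs_sub_comm b t]
  have weighted_lasso := mul_nonneg
    (mul_nonneg hlam (inv_nonneg.2 (Real.rpow_nonneg (abs_nonneg x) γ₁))) triangle_lasso
  have weighted_transfer := mul_nonneg
    (mul_nonneg heta (Real.rpow_nonneg (abs_nonneg x) γ₂)) triangle_transfer
  simp only [penalty]
  linarith

end Penalty

section Objective

variable {n p : ℕ} {X : Matrix (Fin n) (Fin p) ℝ} {y : Fin n → ℝ} {lam eta γ₁ γ₂ : ℝ}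
  {init β b : Fin p → ℝ}

lemma lassoWeight_ne_top (γ₁ : ℝ) {x : ℝ} (hx : x ≠ 0) : lassoWeight γ₁ x ≠ ∞ := by
  simp [lassoWeight, ENNReal.rpow_eq_zero_iff, hx]

lemma toReal_lassoWeight (γ₁ x : ℝ) : (lassoWeight γ₁ x).toReal = (|x| ^ γ₁)⁻¹ := by
  simp [lassoWeight, ← ENNReal.toReal_rpow]

lemma transferWeight_eq_ofReal (hγ₂ : 0 ≤ γ₂) (x : ℝ) :
    transferWeight γ₂ x = ENNReal.ofReal (|x| ^ γ₂) := by
  rw [transferWeight, ENNReal.ofReal_rpow_of_nonneg (abs_nonneg x) hγ₂]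

/-- `β` vanishes wherever the lasso weight is infinite: these are the vectors at which the
objective is finite, when `lam > 0`. -/
def IsAdmissible (γ₁ : ℝ) (init β : Fin p → ℝ) : Prop :=
  ∀ j, lassoWeight γ₁ (init j) = ∞ → β j = 0

lemma isAdmissible_zero : IsAdmissible γ₁ init 0 := fun _ _ => rfl

lemma isAdmissible_of_support_subset (h : Function.support β ⊆ Function.support init) :
    IsAdmissible γ₁ init β := fun j hj => by
  by_contra hβ
  exact lassoWeight_ne_top γ₁ (h hβ) hj

lemma IsAdmissible.objective_eq_ofReal (hβ : IsAdmissible γ₁ init β) (hγ₂ : 0 ≤ γ₂)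
    (hlam : 0 ≤ lam) (heta : 0 ≤ eta) :
    objective X y lam eta γ₁ γ₂ init β = ENNReal.ofReal ((1 / (n : ℝ)) *
      (∑ i, (y i - (X *ᵥ β) i) ^ 2 + ∑ j, penalty lam eta γ₁ γ₂ (init j) (β j))) := by
  have lasso (j : Fin p) : lassoWeight γ₁ (init j) * ENNReal.ofReal |β j|
      = ENNReal.ofReal ((|init j| ^ γ₁)⁻¹ * |β j|) := by
    by_cases h : lassoWeight γ₁ (init j) = ∞
    · simp [hβ j h]
    · rw [ENNReal.ofReal_mul (by positivity), ← toReal_lassoWeight, ENNReal.ofReal_toReal h]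
  have transfer (j : Fin p) : transferWeight γ₂ (init j) * ENNReal.ofReal |β j - init j|
      = ENNReal.ofReal (|init j| ^ γ₂ * |β j - init j|) := by
    rw [transferWeight_eq_ofReal hγ₂, ENNReal.ofReal_mul (by positivity)]
  simp only [objective, lasso, transfer]
  rw [← ENNReal.ofReal_sum_of_nonneg (fun j _ => by positivity),
    ← ENNReal.ofReal_sum_of_nonneg (fun j _ => by positivity),
    ← ENNReal.ofReal_mul (by positivity), ← ENNReal.ofReal_mul (by positivity),
    ← ENNReal.ofReal_add (by positivity) (by positivity),
    ← ENNReal.ofReal_add (by positivity) (by positivity)]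
  simp only [penalty, Finset.sum_add_distrib, ← Finset.mul_sum]
  ring_nf

lemma isAdmissible_of_objective_ne_top (hlam : 0 < lam) (hn : 0 < n)
    (h : objective X y lam eta γ₁ γ₂ init β ≠ ∞) : IsAdmissible γ₁ init β := by
  intro j hj
  by_contra hβ
  have hsum : ∑ j, lassoWeight γ₁ (init j) * ENNReal.ofReal |β j| = ∞ :=
    ENNReal.sum_eq_top.2 ⟨j, Finset.mem_univ j, by rw [hj, ENNReal.top_mul (by simpa using hβ)]⟩
  have hcoef : ENNReal.ofReal (lam / n) ≠ 0 := by
    simpa using div_pos hlam (Nat.cast_pos.2 hn)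
  apply h
  rw [objective, hsum, ENNReal.mul_top hcoef, add_top, top_add]

lemma IsEstimate.isAdmissible (hβ : IsEstimate X y lam eta γ₁ γ₂ init β) (hγ₂ : 0 ≤ γ₂)
    (hlam : 0 < lam) (heta : 0 ≤ eta) (hn : 0 < n) : IsAdmissible γ₁ init β := by
  have hle : objective X y lam eta γ₁ γ₂ init β ≤ objective X y lam eta γ₁ γ₂ init 0 :=
    hβ (Set.mem_univ 0)
  rw [isAdmissible_zero.objective_eq_ofReal hγ₂ hlam.le heta] at hle
  exact isAdmissible_of_objective_ne_top hlam hn (ne_top_of_le_ne_top ENNReal.ofReal_ne_top hle)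

lemma IsEstimate.sum_sq_residual_add_penalty_le (hβ : IsEstimate X y lam eta γ₁ γ₂ init β)
    (hb : IsAdmissible γ₁ init b) (hγ₂ : 0 ≤ γ₂) (hlam : 0 < lam) (heta : 0 ≤ eta) (hn : 0 < n) :
    ∑ i, (y i - (X *ᵥ β) i) ^ 2 + ∑ j, penalty lam eta γ₁ γ₂ (init j) (β j)
      ≤ ∑ i, (y i - (X *ᵥ b) i) ^ 2 + ∑ j, penalty lam eta γ₁ γ₂ (init j) (b j) := by
  have hle : objective X y lam eta γ₁ γ₂ init β ≤ objective X y lam eta γ₁ γ₂ init b :=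
    hβ (Set.mem_univ b)
  have hpen := Finset.sum_nonneg fun j (_ : j ∈ Finset.univ) =>
    penalty_nonneg (γ₁ := γ₁) (γ₂ := γ₂) (x := init j) hlam.le heta (b j)
  rw [(hβ.isAdmissible hγ₂ hlam heta hn).objective_eq_ofReal hγ₂ hlam.le heta,
    hb.objective_eq_ofReal hγ₂ hlam.le heta, ENNReal.ofReal_le_ofReal_iff (by positivity)] at hle
  exact le_of_mul_le_mul_left hle (by positivity)

lemma IsEstimate.basic_inequality (hβ : IsEstimate X y lam eta γ₁ γ₂ init β)
    (hb : IsAdmissible γ₁ init b) (hγ₂ : 0 ≤ γ₂) (hlam : 0 < lam) (heta : 0 ≤ eta) (hn : 0 < n) :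
    (β - b) ⬝ᵥ ((Xᵀ * X) *ᵥ (β - b)) + ∑ j, (penalty lam eta γ₁ γ₂ (init j) (β j)
      - penalty lam eta γ₁ γ₂ (init j) (b j)) ≤ 2 * ‖score X y b‖ * ∑ j, |β j - b j| := by
  have hmin := hβ.sum_sq_residual_add_penalty_le hb hγ₂ hlam heta hn
  have hexpand := sum_sq_residual_sub X y β b
  have hscore := dotProduct_le_norm_mul_sum_abs (β - b) (score X y b)
  simp only [Pi.sub_apply] at hscore
  rw [Finset.sum_sub_distrib]
  linarith

lemma IsEstimate.eq_of_le_penalty_sub (hβ : IsEstimate X y lam eta γ₁ γ₂ init β)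
    (hb : IsAdmissible γ₁ init b) (hγ₂ : 0 ≤ γ₂) (hlam : 0 < lam) (heta : 0 ≤ eta) (hn : 0 < n)
    {t : ℝ} (ht : 2 * ‖score X y b‖ < t)
    (hpen : ∀ j, t * |β j - b j|
      ≤ penalty lam eta γ₁ γ₂ (init j) (β j) - penalty lam eta γ₁ γ₂ (init j) (b j)) :
    β = b := by
  have hbasic := hβ.basic_inequality hb hγ₂ hlam heta hn
  have hquad := dotProduct_gram_mulVec_nonneg X (β - b)
  have hsum := Finset.sum_le_sum fun j (_ : j ∈ Finset.univ) => hpen j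
  rw [← Finset.mul_sum] at hsum
  have hnonneg : ∀ j ∈ Finset.univ, 0 ≤ |β j - b j| := fun j _ => abs_nonneg _
  have hzero : ∑ j, |β j - b j| = 0 := by
    nlinarith [Finset.sum_nonneg hnonneg]
  funext j
  simpa [sub_eq_zero] using (Finset.sum_eq_zero_iff_of_nonneg hnonneg).1 hzero j (Finset.mem_univ j)

lemma IsEstimate.norm_sub_le (hβ : IsEstimate X y lam eta γ₁ γ₂ init β)
    (hb : IsAdmissible γ₁ init b) (hγ₂ : 0 ≤ γ₂) (hlam : 0 < lam) (heta : 0 ≤ eta) (hn : 0 < n)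
    {c L : ℝ} (hc : 0 < c) (hquad : ∀ u, c * ‖u‖ ^ 2 ≤ u ⬝ᵥ ((Xᵀ * X) *ᵥ u)) (hL : 0 ≤ L)
    (hpen : ∀ j, -(L * |β j - b j|)
      ≤ penalty lam eta γ₁ γ₂ (init j) (β j) - penalty lam eta γ₁ γ₂ (init j) (b j)) :
    ‖β - b‖ ≤ p * (2 * ‖score X y b‖ + L) / c := by
  have hbasic := hβ.basic_inequality hb hγ₂ hlam heta hn
  have hsum := Finset.sum_le_sum fun j (_ : j ∈ Finset.univ) => hpen j
  rw [Finset.sum_neg_distrib, ← Finset.mul_sum] at hsum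
  have hl1 : ∑ j, |β j - b j| ≤ p * ‖β - b‖ := by
    simpa using Finset.sum_le_card_nsmul Finset.univ (fun j => |β j - b j|) ‖β - b‖
      fun j _ => norm_le_pi_norm (β - b) j
  have hsq : c * ‖β - b‖ ^ 2 ≤ p * (2 * ‖score X y b‖ + L) * ‖β - b‖ := by
    calc c * ‖β - b‖ ^ 2 ≤ (2 * ‖score X y b‖ + L) * ∑ j, |β j - b j| := by
          linarith [hquad (β - b)]
      _ ≤ (2 * ‖score X y b‖ + L) * (p * ‖β - b‖) := by gcongr
      _ = p * (2 * ‖score X y b‖ + L) * ‖β - b‖ := by ring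
  rcases (norm_nonneg (β - b)).eq_or_lt with h0 | hpos
  · rw [← h0]
    positivity
  · rw [le_div_iff₀ hc]
    exact le_of_mul_le_mul_right (by linarith) hpos

end Objective

section Oracle

variable {n p : ℕ} {X : Matrix (Fin n) (Fin p) ℝ} {lam eta γ₁ γ₂ : ℝ}
  {init β βstar g : Fin p → ℝ} {e : Fin n → ℝ}

/-- In the application `g` is `init` where the transfer penalty is strong, and `β` itself where the
estimate is known to be consistent; `hon` is void in the second case. -/
lemma IsEstimate.support_eq_of_le_penalty_sub
    (hβ : IsEstimate X (X *ᵥ βstar + e) lam eta γ₁ γ₂ init β) (hγ₂ : 0 ≤ γ₂) (hlam : 0 < lam)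
    (heta : 0 ≤ eta) (hn : 0 < n) (hinit : Function.support βstar ⊆ Function.support init)
    (hg : Function.support βstar ⊆ Function.support g) {a t : ℝ} (ha : 0 ≤ a)
    (hX : ∀ u, ‖(Xᵀ * X) *ᵥ u‖ ≤ a * ‖u‖) (ht : 2 * (‖Xᵀ *ᵥ e‖ + a * ‖g - βstar‖) < t)
    (hoff : ∀ j, βstar j = 0 → t * |β j|
      ≤ penalty lam eta γ₁ γ₂ (init j) (β j) - penalty lam eta γ₁ γ₂ (init j) 0)
    (hon : ∀ j, βstar j ≠ 0 → t * |β j - g j|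
      ≤ penalty lam eta γ₁ γ₂ (init j) (β j) - penalty lam eta γ₁ γ₂ (init j) (g j)) :
    Function.support β = Function.support βstar := by
  set b := (Function.support βstar).indicator g with hb
  have hsupport : Function.support b = Function.support βstar := by
    rw [hb, Set.support_indicator, Set.inter_eq_left.2 hg]
  have hscore : 2 * ‖score X (X *ᵥ βstar + e) b‖ < t := by
    have hle := norm_score_mulVec_add_le hX βstar b e
    have hb_sub := mul_le_mul_of_nonneg_left (norm_indicator_support_sub_le βstar g) ha
    linarith
  have heq : β = b := by
    refine hβ.eq_of_le_penalty_sub (isAdmissible_of_support_subset (hsupport.trans_subset hinit))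
      hγ₂ hlam heta hn hscore fun j => ?_
    by_cases hj : βstar j = 0
    · simpa [hb, hj] using hoff j hj
    · simpa [hb, hj] using hon j hj
  rw [heq, hsupport]

end Oracle

section Asymptotics

variable {ι : Type*} {l : Filter ι}

lemma eventually_mul_le_of_isLittleO {f g : ι → ℝ} (h : f =o[l] g) (hg : ∀ᶠ n in l, 0 ≤ g n)
    (B : ℝ) : ∀ᶠ n in l, B * f n ≤ g n := by
  filter_upwards [(h.const_mul_left B).def one_pos, hg] with n hn hgn
  rw [one_mul, Real.norm_eq_abs, Real.norm_of_nonneg hgn] at hn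
  exact (le_abs_self _).trans hn

lemma isLittleO_of_tendsto_div_atTop {f g : ι → ℝ}
    (h : Tendsto (fun n => g n / f n) l atTop) : f =o[l] g := by
  refine (isLittleO_iff_tendsto' ?_).2 ?_
  · filter_upwards [h.eventually_gt_atTop 0] with n hn hg
    simp [hg] at hn
  · simpa only [Pi.inv_def, inv_div] using h.inv_tendsto_atTop

lemma eventually_forall_norm_sub_le {E : Type*} [SeminormedAddCommGroup E] {P : ι → E → Prop}
    {b : E} {d : ι → ℝ} (hP : ∀ᶠ z in l ×ˢ 𝓝 b, P z.1 z.2) (hd : Tendsto d l (𝓝 0)) :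
    ∀ᶠ n in l, ∀ x, ‖x - b‖ ≤ d n → P n x := by
  obtain ⟨pa, hpa, pb, hpb, h⟩ := eventually_prod_iff.1 hP
  obtain ⟨r, hr, hball⟩ := Metric.eventually_nhds_iff.1 hpb
  filter_upwards [hpa, hd.eventually_lt_const hr] with n hn hdn x hx
  exact h hn (hball (by rw [dist_eq_norm]; exact hx.trans_lt hdn))

lemma eventually_support_subset_of_norm_sub_le {κ : Type*} [Fintype κ] (f : κ → ℝ) {d : ι → ℝ}
    (hd : Tendsto d l (𝓝 0)) :
    ∀ᶠ n in l, ∀ g, ‖g - f‖ ≤ d n → Function.support f ⊆ Function.support g := by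
  have hnear : ∀ᶠ g in 𝓝 f, Function.support f ⊆ Function.support g :=
    eventually_all.2 fun j => eventually_imp_distrib_left.2 fun hj =>
      (continuous_apply j).continuousAt.eventually_ne hj
  exact eventually_forall_norm_sub_le (P := fun _ g => Function.support f ⊆ Function.support g)
    (hnear.prod_inr l) hd

end Asymptotics

section PenaltyAsymptotics

variable {ι : Type*} {l : Filter ι} {γ₁ γ₂ : ℝ}

lemma mul_abs_le_penalty_sub_penalty_zero {lam eta x t s K a : ℝ} (hγ₁ : 0 ≤ γ₁) (hγ₂ : 0 ≤ γ₂)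
    (hlam : 0 ≤ lam) (heta : 0 ≤ eta) (hs : 0 < s) (hK : 0 < K) (hx : |x| ≤ K / s)
    (ha : K ^ γ₁ * (a + K ^ γ₂ * (eta / s ^ γ₂)) ≤ lam * s ^ γ₁)
    (ht : lassoWeight γ₁ x = ∞ → t = 0) :
    a * |t| ≤ penalty lam eta γ₁ γ₂ x t - penalty lam eta γ₁ γ₂ x 0 := by
  rcases eq_or_ne (lassoWeight γ₁ x) ∞ with htop | htop
  · simp [ht htop]
  refine le_trans (mul_le_mul_of_nonneg_right ?_ (abs_nonneg t))
    (penalty_sub_penalty_zero_ge heta t)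
  have hxpos : 0 < |x| ^ γ₁ := by
    refine lt_of_le_of_ne (by positivity) fun h0 => htop ?_
    rw [lassoWeight, ENNReal.ofReal_rpow_of_nonneg (abs_nonneg x) hγ₁, ← h0]
    simp
  have hlasso : s ^ γ₁ / K ^ γ₁ ≤ (|x| ^ γ₁)⁻¹ := by
    rw [← inv_div, ← Real.div_rpow hK.le hs.le]
    exact inv_anti₀ hxpos (Real.rpow_le_rpow (abs_nonneg x) hx hγ₁)
  have htransfer : |x| ^ γ₂ ≤ K ^ γ₂ / s ^ γ₂ := by
    rw [← Real.div_rpow hK.le hs.le]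
    exact Real.rpow_le_rpow (abs_nonneg x) hx hγ₂
  calc a ≤ lam * (s ^ γ₁ / K ^ γ₁) - eta * (K ^ γ₂ / s ^ γ₂) := by
        rw [le_sub_iff_add_le, ← mul_div_assoc lam, le_div_iff₀ (by positivity)]
        calc (a + eta * (K ^ γ₂ / s ^ γ₂)) * K ^ γ₁
            = K ^ γ₁ * (a + K ^ γ₂ * (eta / s ^ γ₂)) := by ring
          _ ≤ lam * s ^ γ₁ := ha
    _ ≤ lam * (|x| ^ γ₁)⁻¹ - eta * |x| ^ γ₂ := by gcongr

lemma eventually_mul_abs_le_penalty_sub_penalty_zero (hγ₁ : 0 ≤ γ₁) (hγ₂ : 0 ≤ γ₂)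
    {r s lam eta : ι → ℝ} (hr : ∀ n, 0 ≤ r n) (hlam : ∀ n, 0 ≤ lam n) (heta : ∀ n, 0 ≤ eta n)
    (hs : ∀ᶠ n in l, 0 < s n)
    (h : (fun n => r n + eta n / s n ^ γ₂) =o[l] fun n => lam n * s n ^ γ₁)
    {K : ℝ} (hK : 0 < K) (B : ℝ) :
    ∀ᶠ n in l, ∀ x, |x| ≤ K / s n → ∀ t, (lassoWeight γ₁ x = ∞ → t = 0) →
      B * r n * |t| ≤ penalty (lam n) (eta n) γ₁ γ₂ x t - penalty (lam n) (eta n) γ₁ γ₂ x 0 := by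
  have hnonneg : ∀ᶠ n in l, 0 ≤ lam n * s n ^ γ₁ := by
    filter_upwards [hs] with n hsn
    have := hlam n
    positivity
  filter_upwards [eventually_mul_le_of_isLittleO h hnonneg (K ^ γ₁ * max B (K ^ γ₂)), hs]
    with n hn hsn x hx t ht
  refine mul_abs_le_penalty_sub_penalty_zero hγ₁ hγ₂ (hlam n) (heta n) hsn hK hx ?_ ht
  have hr := hr n
  have hq : 0 ≤ eta n / s n ^ γ₂ := div_nonneg (heta n) (by positivity)
  calc K ^ γ₁ * (B * r n + K ^ γ₂ * (eta n / s n ^ γ₂))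
      ≤ K ^ γ₁ * (max B (K ^ γ₂) * r n + max B (K ^ γ₂) * (eta n / s n ^ γ₂)) := by
        gcongr
        exacts [le_max_left _ _, le_max_right _ _]
    _ = K ^ γ₁ * max B (K ^ γ₂) * (r n + eta n / s n ^ γ₂) := by ring
    _ ≤ lam n * s n ^ γ₁ := hn

lemma tendsto_inv_abs_rpow (γ : ℝ) {b : ℝ} (hb : b ≠ 0) :
    Tendsto (fun x => (|x| ^ γ)⁻¹) (𝓝 b) (𝓝 (|b| ^ γ)⁻¹) :=
  ((continuous_abs.tendsto b).rpow_const (.inl (abs_ne_zero.2 hb))).inv₀ (by positivity)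

lemma eventually_mul_abs_le_penalty_sub_penalty_self (γ₁ γ₂ : ℝ) {b : ℝ} (hb : b ≠ 0)
    {r lam eta : ι → ℝ} (hr : ∀ n, 0 ≤ r n) (hlam : ∀ n, 0 ≤ lam n) (heta : ∀ n, 0 ≤ eta n)
    (h : (fun n => r n + lam n) =o[l] eta) (B : ℝ) :
    ∀ᶠ z in l ×ˢ 𝓝 b, ∀ t, B * r z.1 * |t - z.2| ≤
      penalty (lam z.1) (eta z.1) γ₁ γ₂ z.2 t - penalty (lam z.1) (eta z.1) γ₁ γ₂ z.2 z.2 := by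
  have htransfer : Tendsto (fun x => |x| ^ γ₂) (𝓝 b) (𝓝 (|b| ^ γ₂)) :=
    (continuous_abs.tendsto b).rpow_const (.inl (abs_ne_zero.2 hb))
  set V := (|b| ^ γ₁)⁻¹ + 1
  set W := |b| ^ γ₂ / 2
  have hbpos : 0 < |b| ^ γ₂ := by positivity
  have hW : 0 < W := half_pos hbpos
  have hx : ∀ᶠ x in 𝓝 b, (|x| ^ γ₁)⁻¹ ≤ V ∧ W ≤ |x| ^ γ₂ :=
    ((tendsto_inv_abs_rpow γ₁ hb).eventually_le_const (lt_add_one _)).and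
      (htransfer.eventually_const_le (half_lt_self hbpos))
  have hn := eventually_mul_le_of_isLittleO h (.of_forall heta) (max B V / W)
  filter_upwards [hn.prod_mk hx] with ⟨n, x⟩ ⟨hn, hxV, hxW⟩ t
  refine le_trans (mul_le_mul_of_nonneg_right ?_ (abs_nonneg _))
    (penalty_sub_penalty_self_ge (hlam n) t)
  have hr := hr n
  have hlam := hlam n
  have heta := heta n
  rw [div_mul_eq_mul_div, div_le_iff₀ hW] at hn
  calc B * r n ≤ max B V * r n + max B V * lam n - V * lam n := by
        have hB := mul_le_mul_of_nonneg_right (le_max_left B V) hr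
        have hV := mul_le_mul_of_nonneg_right (le_max_right B V) hlam
        linarith
    _ ≤ eta n * W - lam n * V := by linarith
    _ ≤ eta n * |x| ^ γ₂ - lam n * (|x| ^ γ₁)⁻¹ := by gcongr

lemma eventually_neg_le_penalty_sub_penalty (γ₁ : ℝ) (hγ₂ : 0 ≤ γ₂) (b : ℝ) :
    ∀ᶠ M : ℝ in atTop, ∀ᶠ x in 𝓝 b, ∀ lam eta, 0 ≤ lam → 0 ≤ eta → ∀ t,
      -(M * (lam + eta) * |t - b|) ≤ penalty lam eta γ₁ γ₂ x t - penalty lam eta γ₁ γ₂ x b := by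
  have htransfer : Tendsto (fun x => |x| ^ γ₂) (𝓝 b) (𝓝 (|b| ^ γ₂)) :=
    (continuous_abs.tendsto b).rpow_const (.inr hγ₂)
  rcases eq_or_ne b 0 with rfl | hb
  · filter_upwards [eventually_gt_atTop (|(0 : ℝ)| ^ γ₂), eventually_ge_atTop 0] with M hM hM0
    filter_upwards [htransfer.eventually_le_const hM] with x hx lam eta hlam heta t
    refine le_trans ?_ (penalty_sub_penalty_zero_ge heta t)
    rw [← neg_mul, sub_zero]
    refine mul_le_mul_of_nonneg_right ?_ (abs_nonneg t)
    have hlasso : 0 ≤ lam * (|x| ^ γ₁)⁻¹ := by positivity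
    have hlamM := mul_nonneg hM0 hlam
    have hetaM := mul_le_mul_of_nonneg_left hx heta
    linarith
  · filter_upwards [eventually_gt_atTop ((|b| ^ γ₁)⁻¹), eventually_gt_atTop (|b| ^ γ₂)]
      with M hMlasso hMtransfer
    filter_upwards [(tendsto_inv_abs_rpow γ₁ hb).eventually_le_const hMlasso,
      htransfer.eventually_le_const hMtransfer] with x hxlasso hxtransfer lam eta hlam heta t
    refine le_trans (neg_le_neg (mul_le_mul_of_nonneg_right ?_ (abs_nonneg _)))
      (neg_le_penalty_sub_penalty hlam heta t b)
    have hlamM := mul_le_mul_of_nonneg_left hxlasso hlam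
    have hetaM := mul_le_mul_of_nonneg_left hxtransfer heta
    linarith

end PenaltyAsymptotics

section Regimes

variable {m : ℕ → ℕ} {lam eta : ℕ → ℝ} {γ₁ γ₂ : ℝ}

lemma exists_sqrt_le_mul_sqrt (hnm : (fun n : ℕ => (n : ℝ)) =O[atTop] fun n => (m n : ℝ)) :
    ∃ ρ : ℝ, ∀ᶠ n : ℕ in atTop, √(n : ℝ) ≤ ρ * √(m n : ℝ) := by
  obtain ⟨ρ, hρ, h⟩ := hnm.exists_nonneg
  refine ⟨√ρ, h.bound.mono fun n hn => ?_⟩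
  rw [← Real.sqrt_mul hρ]
  exact Real.sqrt_le_sqrt (by simpa using hn)

lemma tendsto_sqrt_atTop_of_isBigO
    (hnm : (fun n : ℕ => (n : ℝ)) =O[atTop] fun n => (m n : ℝ)) :
    Tendsto (fun n => √(m n : ℝ)) atTop atTop := by
  have hm : Tendsto (fun n => ‖(m n : ℝ)‖) atTop atTop :=
    hnm.trans_tendsto_norm_atTop (tendsto_norm_atTop_atTop.comp tendsto_natCast_atTop_atTop)
  simp only [RCLike.norm_natCast] at hm
  exact Real.tendsto_sqrt_atTop.comp hm

lemma sqrt_rpow {x : ℝ} (hx : 0 ≤ x) (γ : ℝ) : √(x ^ γ) = √x ^ γ := by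
  rw [Real.sqrt_eq_rpow, Real.sqrt_eq_rpow, ← Real.rpow_mul hx, ← Real.rpow_mul hx, mul_comm]

lemma isLittleO_sqrt_of_tendsto_atTop
    (h : Tendsto (fun n : ℕ => √((m n : ℝ) ^ γ₁ / n) * lam n) atTop atTop) :
    (fun n : ℕ => √(n : ℝ)) =o[atTop] fun n => lam n * √(m n : ℝ) ^ γ₁ := by
  refine isLittleO_of_tendsto_div_atTop (h.congr fun n => ?_)
  rw [Real.sqrt_div (by positivity), sqrt_rpow (by positivity)]
  ring

lemma isLittleO_sqrt_natCast : (fun n : ℕ => √(n : ℝ)) =o[atTop] fun n => (n : ℝ) := by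
  refine isLittleO_of_tendsto_div_atTop ?_
  simp only [Real.div_sqrt]
  exact Real.tendsto_sqrt_atTop.comp tendsto_natCast_atTop_atTop

lemma eventually_sqrt_natCast_ne_zero : ∀ᶠ n : ℕ in atTop, √(n : ℝ) ≠ 0 := by
  filter_upwards [eventually_gt_atTop 0] with n hn
  positivity

lemma RootMRegime.isLittleO_lasso (h : RootMRegime m lam eta γ₁ γ₂)
    (hs : Tendsto (fun n => √(m n : ℝ)) atTop atTop) :
    (fun n : ℕ => √(n : ℝ) + eta n / √(m n : ℝ) ^ γ₂)
      =o[atTop] fun n => lam n * √(m n : ℝ) ^ γ₁ := by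
  refine (isLittleO_sqrt_of_tendsto_atTop h.1).add ((isLittleO_iff_tendsto' ?_).2 ?_)
  · filter_upwards [h.1.eventually_gt_atTop 0, hs.eventually_gt_atTop 0] with n hlam hsn hzero
    rcases mul_eq_zero.1 hzero with h0 | h0
    · simp [h0] at hlam
    · exact absurd h0 (by positivity)
  · refine h.2.2.2.congr' ?_
    filter_upwards [hs.eventually_gt_atTop 0] with n hsn
    rw [sqrt_rpow (by positivity), Real.rpow_add hsn, div_div]
    ring_nf

lemma RootMRegime.isLittleO_eta (h : RootMRegime m lam eta γ₁ γ₂) :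
    (fun n : ℕ => √(n : ℝ) + lam n) =o[atTop] eta :=
  (isLittleO_of_tendsto_div_atTop h.2.1).add (isLittleO_of_tendsto_div_atTop h.2.2.1)

lemma RootNRegime.isBigO_sqrt (h : RootNRegime m lam eta γ₁) :
    (fun n : ℕ => √(n : ℝ) + lam n + eta n) =O[atTop] fun n : ℕ => √(n : ℝ) := by
  obtain ⟨-, ⟨lam₀, -, hlam⟩, ⟨eta₀, -, heta⟩⟩ := h
  have isBigO_sqrt_of_tendsto {f : ℕ → ℝ} {a : ℝ}
      (hf : Tendsto (fun n : ℕ => f n / √(n : ℝ)) atTop (𝓝 a)) :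
      f =O[atTop] fun n : ℕ => √(n : ℝ) :=
    isBigO_of_div_tendsto_nhds
      (eventually_sqrt_natCast_ne_zero.mono fun n hn h0 => absurd h0 hn) a hf
  exact ((isBigO_refl _ _).add (isBigO_sqrt_of_tendsto hlam)).add (isBigO_sqrt_of_tendsto heta)

lemma RootNRegime.isLittleO_lasso (h : RootNRegime m lam eta γ₁) :
    (fun n : ℕ => √(n : ℝ) + lam n + eta n) =o[atTop] fun n => lam n * √(m n : ℝ) ^ γ₁ :=
  h.isBigO_sqrt.trans_isLittleO (isLittleO_sqrt_of_tendsto_atTop h.1)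

lemma RootNRegime.isLittleO_natCast (h : RootNRegime m lam eta γ₁) :
    (fun n : ℕ => √(n : ℝ) + lam n + eta n) =o[atTop] fun n => (n : ℝ) :=
  h.isBigO_sqrt.trans_isLittleO isLittleO_sqrt_natCast

lemma SubRootNRegime.isBigO_lam (h : SubRootNRegime lam eta) :
    (fun n : ℕ => √(n : ℝ) + lam n + eta n) =O[atTop] lam := by
  have heta : eta =o[atTop] lam := by
    refine (isLittleO_iff_tendsto' ?_).2 h.2.2
    filter_upwards [h.1.eventually_gt_atTop 0] with n hn h0
    simp [h0] at hn
  exact ((isLittleO_of_tendsto_div_atTop h.1).isBigO.add (isBigO_refl _ _)).add heta.isBigO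

lemma SubRootNRegime.isLittleO_lasso (h : SubRootNRegime lam eta) (hγ₁ : 0 < γ₁)
    (hs : Tendsto (fun n => √(m n : ℝ)) atTop atTop) :
    (fun n : ℕ => √(n : ℝ) + lam n + eta n) =o[atTop] fun n => lam n * √(m n : ℝ) ^ γ₁ := by
  have hone : (fun _ => (1 : ℝ)) =o[atTop] fun n => √(m n : ℝ) ^ γ₁ :=
    isLittleO_of_tendsto_div_atTop
      (by simpa [Function.comp_def] using (tendsto_rpow_atTop hγ₁).comp hs)
  simpa using h.isBigO_lam.mul_isLittleO hone

lemma SubRootNRegime.isLittleO_natCast (h : SubRootNRegime lam eta) :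
    (fun n : ℕ => √(n : ℝ) + lam n + eta n) =o[atTop] fun n => (n : ℝ) := by
  refine h.isBigO_lam.trans_isLittleO ((isLittleO_iff_tendsto' ?_).2 h.2.1)
  filter_upwards [eventually_gt_atTop 0] with n hn h0
  exact absurd h0 (by positivity)

end Regimes

section GramLimit

variable {κ : Type*} [Fintype κ] {C : Matrix κ κ ℝ}

lemma exists_eventually_mul_norm_sq_le (hC : C.PosDef) :
    ∃ c > 0, ∀ᶠ A in 𝓝 C, ∀ u, c * ‖u‖ ^ 2 ≤ u ⬝ᵥ (A *ᵥ u) := by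
  have hcont : Continuous fun z : Matrix κ κ ℝ × (κ → ℝ) => z.2 ⬝ᵥ (z.1 *ᵥ z.2) :=
    continuous_snd.dotProduct (continuous_fst.matrix_mulVec continuous_snd)
  have hpos : ∀ u ∈ Metric.sphere (0 : κ → ℝ) 1, 0 < u ⬝ᵥ (C *ᵥ u) := fun u hu => by
    simpa using hC.dotProduct_mulVec_pos (ne_zero_of_mem_unit_sphere ⟨u, hu⟩)
  obtain ⟨c, hc, hmin⟩ := (isCompact_sphere (0 : κ → ℝ) 1).exists_forall_le'
    (hcont.comp (.prodMk_right C)).continuousOn hpos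
  refine ⟨c / 2, half_pos hc, ?_⟩
  have hsphere : ∀ᶠ A in 𝓝 C, ∀ u ∈ Metric.sphere (0 : κ → ℝ) 1, c / 2 < u ⬝ᵥ (A *ᵥ u) :=
    (isCompact_sphere _ _).eventually_forall_of_forall_eventually fun u hu =>
      hcont.continuousAt.eventually_const_lt ((half_lt_self hc).trans_le (hmin u hu))
  filter_upwards [hsphere] with A hA u
  rcases eq_or_ne u 0 with rfl | hu
  · simp
  have hnorm : ‖u‖ ≠ 0 := norm_ne_zero_iff.2 hu
  have hunit := hA (‖u‖⁻¹ • u) (by simp [norm_smul, hnorm])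
  rw [Matrix.mulVec_smul, dotProduct_smul, smul_dotProduct, smul_eq_mul, smul_eq_mul,
    ← mul_assoc, ← mul_inv, inv_mul_eq_div, lt_div_iff₀ (by positivity)] at hunit
  rw [sq]
  exact hunit.le

lemma exists_eventually_norm_mulVec_le (C : Matrix κ κ ℝ) :
    ∃ a ≥ 0, ∀ᶠ A in 𝓝 C, ∀ u, ‖A *ᵥ u‖ ≤ a * ‖u‖ := by
  classical
  let Φ : Matrix κ κ ℝ →ₗ[ℝ] (κ → ℝ) →L[ℝ] (κ → ℝ) :=
    LinearMap.toContinuousLinearMap.toLinearMap ∘ₗ Matrix.toLin'.toLinearMap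
  have hΦ : Continuous Φ := Φ.continuous_of_finiteDimensional
  refine ⟨‖Φ C‖ + 1, by positivity, ?_⟩
  filter_upwards [hΦ.norm.continuousAt.eventually_le_const (lt_add_one ‖Φ C‖)] with A hA u
  exact ((Φ A).le_opNorm u).trans (mul_le_mul_of_nonneg_right hA (norm_nonneg u))

variable {X : (n : ℕ) → Matrix (Fin n) κ ℝ}

lemma exists_eventually_mul_norm_sq_le_gram (hC : C.PosDef)
    (hXC : Tendsto (fun n : ℕ => (1 / (n : ℝ)) • ((X n)ᵀ * X n)) atTop (𝓝 C)) :
    ∃ c > 0, ∀ᶠ n : ℕ in atTop, ∀ u, c * n * ‖u‖ ^ 2 ≤ u ⬝ᵥ (((X n)ᵀ * X n) *ᵥ u) := by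
  obtain ⟨c, hc, h⟩ := exists_eventually_mul_norm_sq_le hC
  refine ⟨c, hc, ?_⟩
  filter_upwards [hXC.eventually h, eventually_gt_atTop 0] with n hn hpos u
  have hu := hn u
  rw [Matrix.smul_mulVec, dotProduct_smul, smul_eq_mul, one_div_mul_eq_div,
    le_div_iff₀ (by positivity)] at hu
  linarith

lemma exists_eventually_norm_gram_mulVec_le
    (hXC : Tendsto (fun n : ℕ => (1 / (n : ℝ)) • ((X n)ᵀ * X n)) atTop (𝓝 C)) :
    ∃ a ≥ 0, ∀ᶠ n : ℕ in atTop, ∀ u, ‖((X n)ᵀ * X n) *ᵥ u‖ ≤ a * n * ‖u‖ := by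
  obtain ⟨a, ha, h⟩ := exists_eventually_norm_mulVec_le C
  refine ⟨a, ha, ?_⟩
  filter_upwards [hXC.eventually h, eventually_gt_atTop 0] with n hn hpos u
  have hu := hn u
  rw [Matrix.smul_mulVec, norm_smul, Real.norm_of_nonneg (by positivity), one_div_mul_eq_div,
    div_le_iff₀ (by positivity)] at hu
  linarith

end GramLimit

section Selection

variable {p : ℕ} {X : (n : ℕ) → Matrix (Fin n) (Fin p) ℝ} {C : Matrix (Fin p) (Fin p) ℝ}
  {βstar : Fin p → ℝ} {lam eta s : ℕ → ℝ} {γ₁ γ₂ K : ℝ}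

/-- For responses `X β* + e`, every estimate has the support of `β*`, whatever the initial estimate
at distance at most `d` from `β*` and the noise `e` with `‖Xᵀ e‖ ≤ g`. This is the deterministic
part of consistent selection: both bounds hold with high probability. -/
def SelectsWithin {n : ℕ} (X : Matrix (Fin n) (Fin p) ℝ) (βstar : Fin p → ℝ)
    (lam eta γ₁ γ₂ d g : ℝ) : Prop :=
  ∀ init e β, ‖init - βstar‖ ≤ d → ‖Xᵀ *ᵥ e‖ ≤ g →
    IsEstimate X (X *ᵥ βstar + e) lam eta γ₁ γ₂ init β →
    Function.support β = Function.support βstar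

lemma eventually_pos_of_isLittleO_mul {ι : Type*} {l : Filter ι} {f lam g : ι → ℝ}
    (h : f =o[l] fun n => lam n * g n) (hf : ∀ᶠ n in l, 0 < f n) (hlam : ∀ n, 0 ≤ lam n) :
    ∀ᶠ n in l, 0 < lam n := by
  filter_upwards [h.isBigO.eq_zero_imp, hf] with n hzero hfn
  refine (hlam n).lt_of_ne fun h0 => hfn.ne' (hzero ?_)
  rw [← h0, zero_mul]

lemma isBigO_div_rpow_self {ι : Type*} {l : Filter ι} {s : ι → ℝ} {γ : ℝ} (f : ι → ℝ)
    (hs : Tendsto s l atTop) (hγ : 0 ≤ γ) : (fun n => f n / s n ^ γ) =O[l] f := by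
  refine .of_bound 1 ?_
  filter_upwards [hs.eventually_ge_atTop 1] with n hsn
  have hone : 1 ≤ s n ^ γ := Real.one_le_rpow hsn hγ
  rw [one_mul, norm_div, Real.norm_of_nonneg (zero_le_one.trans hone)]
  exact div_le_self (norm_nonneg _) hone

/-- With a strong transfer penalty, the estimate copies `init` on the support of `β*`. -/
lemma eventually_selectsWithin_of_isLittleO_eta
    (hXC : Tendsto (fun n : ℕ => (1 / (n : ℝ)) • ((X n)ᵀ * X n)) atTop (𝓝 C))
    (hγ₁ : 0 ≤ γ₁) (hγ₂ : 0 ≤ γ₂) (hlam : ∀ n, 0 ≤ lam n) (heta : ∀ n, 0 ≤ eta n)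
    (hs : Tendsto s atTop atTop) {ρ : ℝ} (hns : ∀ᶠ n : ℕ in atTop, √(n : ℝ) ≤ ρ * s n)
    (hlasso : (fun n : ℕ => √(n : ℝ) + eta n / s n ^ γ₂) =o[atTop] fun n => lam n * s n ^ γ₁)
    (htransfer : (fun n : ℕ => √(n : ℝ) + lam n) =o[atTop] eta) (hK : 0 < K) :
    ∀ᶠ n : ℕ in atTop,
      SelectsWithin (X n) βstar (lam n) (eta n) γ₁ γ₂ (K / s n) (K * √(n : ℝ)) := by
  obtain ⟨a, ha, hgram⟩ := exists_eventually_norm_gram_mulVec_le hXC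
  set B := 2 * (K + a * K * ρ) + 1
  have hd : Tendsto (fun n => K / s n) atTop (𝓝 0) := hs.const_div_atTop K
  have hon : ∀ᶠ n : ℕ in atTop, ∀ j, βstar j ≠ 0 → ∀ x, ‖x - βstar j‖ ≤ K / s n → ∀ t,
      B * √(n : ℝ) * |t - x|
        ≤ penalty (lam n) (eta n) γ₁ γ₂ x t - penalty (lam n) (eta n) γ₁ γ₂ x x :=
    eventually_all.2 fun j => eventually_imp_distrib_left.2 fun hj =>
      eventually_forall_norm_sub_le (eventually_mul_abs_le_penalty_sub_penalty_self γ₁ γ₂ hj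
        (fun n : ℕ => (n : ℝ).sqrt_nonneg) hlam heta htransfer B) hd
  have hlam_pos : ∀ᶠ n in atTop, 0 < lam n := by
    refine eventually_pos_of_isLittleO_mul hlasso ?_ hlam
    filter_upwards [eventually_gt_atTop 0, hs.eventually_gt_atTop 0] with n hn hsn
    have := heta n
    positivity
  filter_upwards [hgram, hon, hlam_pos, hns, hs.eventually_gt_atTop 0, eventually_gt_atTop 0,
    eventually_support_subset_of_norm_sub_le βstar hd,
    eventually_mul_abs_le_penalty_sub_penalty_zero hγ₁ hγ₂ (fun n : ℕ => (n : ℝ).sqrt_nonneg) hlam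
      heta (hs.eventually_gt_atTop 0) hlasso hK B]
    with n hgram hon hlam_n hns hsn hn hsupport hoff init e β hinit he hβ
  have hbias : a * n * ‖init - βstar‖ ≤ a * K * ρ * √(n : ℝ) := by
    calc a * n * ‖init - βstar‖ ≤ a * n * (K / s n) := by gcongr
      _ = a * K * √(n : ℝ) * (√(n : ℝ) / s n) := by
        nth_rw 1 [← Real.mul_self_sqrt n.cast_nonneg]
        ring
      _ ≤ a * K * √(n : ℝ) * ρ := by
        gcongr
        exact (div_le_iff₀ hsn).2 hns
      _ = a * K * ρ * √(n : ℝ) := by ring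
  have hcoord (j : Fin p) : ‖init j - βstar j‖ ≤ K / s n :=
    (norm_le_pi_norm (init - βstar) j).trans hinit
  have hsqrt : 0 < √(n : ℝ) := by positivity
  refine hβ.support_eq_of_le_penalty_sub hγ₂ hlam_n (heta n) hn (hsupport init hinit)
    (hsupport init hinit) (a := a * n) (t := B * √(n : ℝ)) (by positivity) hgram
    (by linarith) (fun j hj => hoff _ ?_ _ (hβ.isAdmissible hγ₂ hlam_n (heta n) hn j))
    (fun j hj => hon j hj _ (hcoord j) _)
  simpa [hj] using hcoord j

lemma exists_eventually_norm_sub_le (hC : C.PosDef)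
    (hXC : Tendsto (fun n : ℕ => (1 / (n : ℝ)) • ((X n)ᵀ * X n)) atTop (𝓝 C))
    (hγ₂ : 0 ≤ γ₂) (heta : ∀ n, 0 ≤ eta n)
    (hlam_pos : ∀ᶠ n in atTop, 0 < lam n) (hs : Tendsto s atTop atTop) (hK : 0 ≤ K) :
    ∃ Q : ℝ, ∀ᶠ n : ℕ in atTop, ∀ init e β, ‖init - βstar‖ ≤ K / s n →
      ‖(X n)ᵀ *ᵥ e‖ ≤ K * √(n : ℝ) →
      IsEstimate (X n) (X n *ᵥ βstar + e) (lam n) (eta n) γ₁ γ₂ init β →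
      ‖β - βstar‖ ≤ Q * ((√(n : ℝ) + lam n + eta n) / n) := by
  obtain ⟨c, hc, hquad⟩ := exists_eventually_mul_norm_sq_le_gram hC hXC
  obtain ⟨M, hM, hM0⟩ := ((eventually_all.2 fun j =>
    eventually_neg_le_penalty_sub_penalty γ₁ hγ₂ (βstar j)).and (eventually_ge_atTop 0)).exists
  have hd : Tendsto (fun n => K / s n) atTop (𝓝 0) := hs.const_div_atTop K
  have hpen : ∀ᶠ n in atTop, ∀ j, ∀ x, ‖x - βstar j‖ ≤ K / s n → ∀ lam eta, 0 ≤ lam → 0 ≤ eta →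
      ∀ t, -(M * (lam + eta) * |t - βstar j|)
        ≤ penalty lam eta γ₁ γ₂ x t - penalty lam eta γ₁ γ₂ x (βstar j) :=
    eventually_all.2 fun j => eventually_forall_norm_sub_le ((hM j).prod_inr _) hd
  refine ⟨p * (2 * K + M) / c, ?_⟩
  filter_upwards [hquad, hpen, hlam_pos, eventually_gt_atTop 0,
    eventually_support_subset_of_norm_sub_le βstar hd]
    with n hquad hpen hlam_n hn hsupport init e β hinit he hβ
  have heta_n := heta n
  calc ‖β - βstar‖
      ≤ p * (2 * ‖(X n)ᵀ *ᵥ e‖ + M * (lam n + eta n)) / (c * n) := by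
        rw [← score_mulVec_add_self (X n) βstar e]
        exact hβ.norm_sub_le (isAdmissible_of_support_subset (hsupport init hinit)) hγ₂ hlam_n
          heta_n hn (by positivity) hquad (by positivity)
          fun j => hpen j _ ((norm_le_pi_norm (init - βstar) j).trans hinit) _ _ hlam_n.le heta_n _
    _ ≤ p * ((2 * K + M) * (√(n : ℝ) + lam n + eta n)) / (c * n) := by
        gcongr
        have hsqrt := mul_nonneg hM0 (n : ℝ).sqrt_nonneg
        have hweights := mul_nonneg hK (add_nonneg hlam_n.le heta_n)
        linarith
    _ = p * (2 * K + M) / c * ((√(n : ℝ) + lam n + eta n) / n) := by ring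

/-- The comparison vector is `β` itself, restricted to the support of `β*`: it is as close to `β*`
as `β` is, and differs from `β` only off the support. -/
lemma eventually_selectsWithin_of_isLittleO_natCast (hC : C.PosDef)
    (hXC : Tendsto (fun n : ℕ => (1 / (n : ℝ)) • ((X n)ᵀ * X n)) atTop (𝓝 C))
    (hγ₁ : 0 ≤ γ₁) (hγ₂ : 0 ≤ γ₂) (hlam : ∀ n, 0 ≤ lam n) (heta : ∀ n, 0 ≤ eta n)
    (hs : Tendsto s atTop atTop)
    (hlasso : (fun n : ℕ => √(n : ℝ) + lam n + eta n) =o[atTop] fun n => lam n * s n ^ γ₁)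
    (hrate : (fun n : ℕ => √(n : ℝ) + lam n + eta n) =o[atTop] fun n => (n : ℝ)) (hK : 0 < K) :
    ∀ᶠ n : ℕ in atTop,
      SelectsWithin (X n) βstar (lam n) (eta n) γ₁ γ₂ (K / s n) (K * √(n : ℝ)) := by
  set r : ℕ → ℝ := fun n => √(n : ℝ) + lam n + eta n
  have hsqrt_le (n : ℕ) : √(n : ℝ) ≤ r n := by linarith [hlam n, heta n]
  have hr_nonneg (n : ℕ) : 0 ≤ r n := (Real.sqrt_nonneg _).trans (hsqrt_le n)
  have hr_pos : ∀ᶠ n in atTop, 0 < r n := by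
    filter_upwards [eventually_gt_atTop 0] with n hn
    exact (Real.sqrt_pos.2 (by exact_mod_cast hn)).trans_le (hsqrt_le n)
  have hlam_pos := eventually_pos_of_isLittleO_mul hlasso hr_pos hlam
  obtain ⟨a, ha, hgram⟩ := exists_eventually_norm_gram_mulVec_le hXC
  obtain ⟨Q, hclose⟩ := exists_eventually_norm_sub_le (βstar := βstar) (γ₁ := γ₁) hC hXC hγ₂
    heta hlam_pos hs hK.le
  have htransfer : (fun n => eta n / s n ^ γ₂) =O[atTop] r := by
    refine (isBigO_div_rpow_self eta hs hγ₂).trans (isBigO_of_le _ fun n => ?_)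
    rw [Real.norm_of_nonneg (heta n), Real.norm_of_nonneg (hr_nonneg n)]
    exact le_add_of_nonneg_left (add_nonneg (Real.sqrt_nonneg _) (hlam n))
  set B := 2 * (K + a * Q) + 1
  filter_upwards [hgram, hclose, hlam_pos, hr_pos, eventually_gt_atTop 0,
    eventually_support_subset_of_norm_sub_le βstar (hs.const_div_atTop K),
    eventually_support_subset_of_norm_sub_le βstar
      (by simpa using hrate.tendsto_div_nhds_zero.const_mul Q),
    eventually_mul_abs_le_penalty_sub_penalty_zero hγ₁ hγ₂ hr_nonneg hlam heta
      (hs.eventually_gt_atTop 0) (((isBigO_refl r _).add htransfer).trans_isLittleO hlasso) hK B]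
    with n hgram hclose hlam_n hr_n hn hinit_support hsupport hoff init e β hinit he hβ
  have hβ_close := hclose init e β hinit he hβ
  have hbias : a * n * ‖β - βstar‖ ≤ a * Q * r n := by
    calc a * n * ‖β - βstar‖ ≤ a * n * (Q * (r n / n)) := by gcongr
      _ = a * Q * r n := by field_simp
  have hnoise : K * √(n : ℝ) ≤ K * r n := mul_le_mul_of_nonneg_left (hsqrt_le n) hK.le
  refine hβ.support_eq_of_le_penalty_sub hγ₂ hlam_n (heta n) hn (hinit_support init hinit)
    (hsupport β hβ_close) (a := a * n) (t := B * r n) (by positivity) hgram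
    (by linarith) (fun j hj => hoff _ ?_ _ (hβ.isAdmissible hγ₂ hlam_n (heta n) hn j))
    (fun j _ => by simp)
  simpa [hj] using (norm_le_pi_norm (init - βstar) j).trans hinit

end Selection

section Tightness

variable {Ω : Type*} [MeasurableSpace Ω] {μ : Measure Ω}

/-- `Z n = O_P(1)`. The bound `K` is quantified by `∀ᶠ` rather than `∃`, so that several sequences
can be given a common bound. -/
def BoundedInProbability {E : Type*} [Norm E] (μ : Measure Ω) (Z : ℕ → Ω → E) : Prop :=
  ∀ δ > 0, ∀ᶠ K : ℝ in atTop, ∀ᶠ n in atTop, μ {ω | K < ‖Z n ω‖} ≤ δ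

lemma boundedInProbability_pi {κ E : Type*} [Fintype κ] [SeminormedAddCommGroup E]
    {Z : ℕ → Ω → κ → E} (h : ∀ j, BoundedInProbability μ fun n ω => Z n ω j) :
    BoundedInProbability μ Z := by
  intro δ hδ
  have hδ' : 0 < δ / Fintype.card κ := ENNReal.div_pos hδ.ne' (ENNReal.natCast_ne_top _)
  filter_upwards [eventually_all.2 fun j => h j _ hδ', eventually_ge_atTop 0] with K hK hK0
  filter_upwards [eventually_all.2 hK] with n hn
  have hsub : {ω | K < ‖Z n ω‖} ⊆ ⋃ j, {ω | K < ‖Z n ω j‖} := fun ω hω => by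
    by_contra hω'
    simp only [Set.mem_iUnion, Set.mem_ofPred_eq, not_exists, not_lt] at hω'
    exact hω.not_ge ((pi_norm_le_iff_of_nonneg hK0).2 hω')
  calc μ {ω | K < ‖Z n ω‖} ≤ ∑ j, μ {ω | K < ‖Z n ω j‖} :=
        (measure_mono hsub).trans (measure_iUnion_fintype_le μ _)
    _ ≤ ∑ _j : κ, δ / Fintype.card κ := Finset.sum_le_sum fun j _ => hn j
    _ ≤ δ := by simpa using ENNReal.mul_div_le

lemma boundedInProbability_of_tendstoInDistribution {Ω' E : Type*} [MeasurableSpace Ω']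
    {μ' : Measure Ω'} [IsProbabilityMeasure μ] [IsProbabilityMeasure μ'] [NormedAddCommGroup E]
    [MeasurableSpace E] [BorelSpace E] [SecondCountableTopology E] [CompleteSpace E]
    {Z : ℕ → Ω → E} {Z' : Ω' → E} (hZ : TendstoInDistribution Z atTop Z' (fun _ => μ) μ') :
    BoundedInProbability μ Z := by
  intro δ hδ
  have htight := tendsto_measure_norm_gt_of_isTightMeasureSet
    (isTightMeasureSet_singleton (μ := μ'.map Z'))
  obtain ⟨r, hr⟩ := (htight.eventually_lt_const hδ).exists
  simp only [Set.mem_singleton_iff, iSup_iSup_eq_left] at hr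
  filter_upwards [eventually_gt_atTop r] with K hK
  have hclosed : IsClosed {x : E | K ≤ ‖x‖} := isClosed_le continuous_const continuous_norm
  have hlimsup := ProbabilityMeasure.limsup_measure_closed_le_of_tendsto hZ.tendsto hclosed
  have hlimit : (μ'.map Z') {x : E | K ≤ ‖x‖} < δ :=
    (measure_mono fun x (hx : K ≤ ‖x‖) => hK.trans_le hx).trans_lt hr
  filter_upwards [eventually_lt_of_limsup_lt (hlimsup.trans_lt hlimit)] with n hn
  simp only [ProbabilityMeasure.coe_mk] at hn
  rw [Measure.map_apply_of_aemeasurable (hZ.forall_aemeasurable n) hclosed.measurableSet] at hn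
  exact (measure_mono fun ω (hω : K < ‖Z n ω‖) => hω.le).trans hn.le

lemma boundedInProbability_of_variance_le [IsFiniteMeasure μ] {Z : ℕ → Ω → ℝ} {v : ℝ}
    (hmem : ∀ n, MemLp (Z n) 2 μ) (hmean : ∀ n, μ[Z n] = 0)
    (hvar : ∀ᶠ n in atTop, Var[Z n; μ] ≤ v) : BoundedInProbability μ Z := by
  intro δ hδ
  have hlim : Tendsto (fun K : ℝ => ENNReal.ofReal (v / K ^ 2)) atTop (𝓝 0) := by
    simpa using ENNReal.tendsto_ofReal ((tendsto_pow_atTop two_ne_zero).const_div_atTop v)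
  filter_upwards [hlim.eventually_le_const hδ, eventually_gt_atTop 0] with K hKδ hK
  filter_upwards [hvar] with n hn
  have chebyshev := meas_ge_le_variance_div_sq (hmem n) hK
  simp only [hmean n, sub_zero] at chebyshev
  calc μ {ω | K < ‖Z n ω‖} ≤ μ {ω | K ≤ |Z n ω|} :=
        measure_mono fun ω (hω : K < |Z n ω|) => hω.le
    _ ≤ ENNReal.ofReal (Var[Z n; μ] / K ^ 2) := chebyshev
    _ ≤ ENNReal.ofReal (v / K ^ 2) := ENNReal.ofReal_le_ofReal (by gcongr)
    _ ≤ δ := hKδ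

lemma tendsto_measure_one_of_eventually_compl_le {ι : Type*} {l : Filter ι}
    [IsProbabilityMeasure μ] {A : ι → Set Ω} (h : ∀ δ > 0, ∀ᶠ n in l, μ (A n)ᶜ ≤ δ) :
    Tendsto (fun n => μ (A n)) l (𝓝 1) := by
  refine (ENNReal.tendsto_nhds ENNReal.one_ne_top).2 fun δ hδ => ?_
  filter_upwards [h δ hδ] with n hn
  refine ⟨tsub_le_iff_right.2 ?_, prob_le_one.trans le_self_add⟩
  calc (1 : ℝ≥0∞) = μ Set.univ := measure_univ.symm
    _ ≤ μ (A n) + μ (A n)ᶜ := measure_univ_le_add_compl _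
    _ ≤ μ (A n) + δ := by gcongr

end Tightness

section Noise

variable {Ω : Type*} [MeasurableSpace Ω] {μ : Measure Ω} {κ : Type*} [Fintype κ]

lemma variance_dotProduct_le [IsFiniteMeasure μ] {ι : Type*} [Fintype ι] {e : Ω → ι → ℝ} {v : ℝ}
    (hmem : ∀ i, MemLp (fun ω => e ω i) 2 μ)
    (huncorr : Pairwise fun i j => cov[fun ω => e ω i, fun ω => e ω j; μ] = 0)
    (hvar : ∀ i, Var[fun ω => e ω i; μ] ≤ v) (w : ι → ℝ) :
    Var[fun ω => w ⬝ᵥ e ω; μ] ≤ v * (w ⬝ᵥ w) := by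
  simp only [dotProduct]
  rw [variance_fun_sum fun i => (hmem i).const_mul (w i), Finset.mul_sum]
  refine Finset.sum_le_sum fun i _ => ?_
  rw [Finset.sum_eq_single i (fun j _ hj => ?_) (by simp)]
  · rw [covariance_self ((hmem i).aemeasurable.const_mul _), variance_const_mul]
    nlinarith [hvar i, sq_nonneg (w i)]
  · rw [covariance_const_mul_left, covariance_const_mul_right, huncorr hj.symm, mul_zero, mul_zero]

lemma boundedInProbability_inv_sqrt_smul_transpose_mulVec [IsFiniteMeasure μ]
    {X : (n : ℕ) → Matrix (Fin n) κ ℝ} {C : Matrix κ κ ℝ}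
    (hXC : Tendsto (fun n : ℕ => (1 / (n : ℝ)) • ((X n)ᵀ * X n)) atTop (𝓝 C))
    {ε : (n : ℕ) → Ω → Fin n → ℝ} {v : ℝ} (hmem : ∀ n i, MemLp (fun ω => ε n ω i) 2 μ)
    (hmean : ∀ n i, ∫ ω, ε n ω i ∂μ = 0)
    (huncorr : ∀ n, Pairwise fun i j => cov[fun ω => ε n ω i, fun ω => ε n ω j; μ] = 0)
    (hvar : ∀ n i, Var[fun ω => ε n ω i; μ] ≤ v) (hv : 0 ≤ v) :
    BoundedInProbability μ fun n ω => (√(n : ℝ))⁻¹ • ((X n)ᵀ *ᵥ ε n ω) := by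
  refine boundedInProbability_pi fun j => boundedInProbability_of_variance_le
    (v := v * (C j j + 1)) (fun n => ?_) (fun n => ?_) ?_
  · change MemLp (fun ω => (√(n : ℝ))⁻¹ * ∑ i, (X n)ᵀ j i * ε n ω i) 2 μ
    exact (memLp_finsetSum _ fun i _ => (hmem n i).const_mul _).const_mul _
  · simp only [Pi.smul_apply, smul_eq_mul, Matrix.mulVec, dotProduct]
    rw [integral_const_mul, integral_finsetSum _ fun i _ =>
      ((hmem n i).const_mul _).integrable one_le_two]
    simp [integral_const_mul, hmean]
  · have hentry : Tendsto (fun n : ℕ => 1 / (n : ℝ) * ((X n)ᵀ * X n) j j) atTop (𝓝 (C j j)) :=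
      (hXC.apply_nhds j).apply_nhds j
    filter_upwards [hentry.eventually_le_const (lt_add_one (C j j))] with n hn
    calc Var[fun ω => (√(n : ℝ))⁻¹ * ((X n)ᵀ j ⬝ᵥ ε n ω); μ]
        = 1 / (n : ℝ) * Var[fun ω => (X n)ᵀ j ⬝ᵥ ε n ω; μ] := by
          rw [variance_const_mul, inv_pow, Real.sq_sqrt n.cast_nonneg, one_div]
      _ ≤ 1 / (n : ℝ) * (v * ((X n)ᵀ j ⬝ᵥ (X n)ᵀ j)) := by
          gcongr
          exact variance_dotProduct_le (hmem n) (huncorr n) (hvar n) _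
      _ = v * (1 / (n : ℝ) * ((X n)ᵀ * X n) j j) := by
          rw [Matrix.mul_apply, dotProduct]
          simp only [Matrix.transpose_apply]
          ring
      _ ≤ v * (C j j + 1) := mul_le_mul_of_nonneg_left hn hv

lemma boundedInProbability_inv_sqrt_smul_transpose_mulVec_gaussian [IsProbabilityMeasure μ]
    {X : (n : ℕ) → Matrix (Fin n) κ ℝ} {C : Matrix κ κ ℝ}
    (hXC : Tendsto (fun n : ℕ => (1 / (n : ℝ)) • ((X n)ᵀ * X n)) atTop (𝓝 C))
    {v : ℝ≥0} {ε : (n : ℕ) → Ω → Fin n → ℝ}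
    (hlaw : ∀ n i, HasLaw (fun ω => ε n ω i) (gaussianReal 0 v) μ)
    (hindep : ∀ n, iIndepFun (fun (i : Fin n) ω => ε n ω i) μ) :
    BoundedInProbability μ fun n ω => (√(n : ℝ))⁻¹ • ((X n)ᵀ *ᵥ ε n ω) := by
  have hmem (n : ℕ) (i : Fin n) : MemLp (fun ω => ε n ω i) 2 μ := by
    refine MemLp.comp_of_map (g := id) ?_ (hlaw n i).aemeasurable
    rw [(hlaw n i).map_eq]
    exact memLp_id_gaussianReal 2
  refine boundedInProbability_inv_sqrt_smul_transpose_mulVec hXC hmem (fun n i => ?_)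
    (fun n i j hij => ((hindep n).indepFun hij).covariance_eq_zero (hmem n i) (hmem n j))
    (fun n i => ?_) v.coe_nonneg
  · rw [(hlaw n i).integral_eq, integral_id_gaussianReal]
  · rw [(hlaw n i).variance_eq, variance_id_gaussianReal]

end Noise

section Consistency

lemma consistentActiveSelection_of_eventually_selectsWithin {Ω : Type*} [MeasurableSpace Ω]
    {μ : Measure Ω} [IsProbabilityMeasure μ] {p : ℕ} {X : (n : ℕ) → Matrix (Fin n) (Fin p) ℝ}
    {βstar : Fin p → ℝ} {ε : (n : ℕ) → Ω → Fin n → ℝ} {βinit βhat : ℕ → Ω → Fin p → ℝ}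
    {lam eta s : ℕ → ℝ} {γ₁ γ₂ : ℝ} (hs : ∀ᶠ n in atTop, 0 < s n)
    (hinit : BoundedInProbability μ fun n ω => s n • (βinit n ω - βstar))
    (hscore : BoundedInProbability μ fun n ω => (√(n : ℝ))⁻¹ • ((X n)ᵀ *ᵥ ε n ω))
    (hsel : ∀ K > 0, ∀ᶠ n : ℕ in atTop,
      SelectsWithin (X n) βstar (lam n) (eta n) γ₁ γ₂ (K / s n) (K * √(n : ℝ)))
    (hβhat : ∀ᶠ n in atTop, ∀ᵐ ω ∂μ, IsEstimate (X n) (X n *ᵥ βstar + ε n ω) (lam n) (eta n) γ₁ γ₂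
      (βinit n ω) (βhat n ω)) :
    ConsistentActiveSelection μ βhat βstar := by
  refine tendsto_measure_one_of_eventually_compl_le fun δ hδ => ?_
  obtain ⟨K, ⟨hKinit, hKscore⟩, hK⟩ := (((hinit _ (ENNReal.half_pos hδ.ne')).and
    (hscore _ (ENNReal.half_pos hδ.ne'))).and (eventually_gt_atTop 0)).exists
  filter_upwards [hKinit, hKscore, hsel K hK, hs, hβhat, eventually_gt_atTop 0]
    with n hKinit hKscore hsel hsn hβhat hn
  have hsqrt : 0 < √(n : ℝ) := by positivity
  calc μ {ω | Function.support (βhat n ω) = Function.support βstar}ᶜ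
      ≤ μ ({ω | K < ‖s n • (βinit n ω - βstar)‖}
          ∪ {ω | K < ‖(√(n : ℝ))⁻¹ • ((X n)ᵀ *ᵥ ε n ω)‖}) := by
        refine measure_mono_ae ?_
        filter_upwards [hβhat] with ω hω hne
        by_contra hgood
        obtain ⟨hinit_le, hscore_le⟩ := not_or.1 hgood
        rw [Set.mem_ofPred_eq, not_lt, norm_smul, Real.norm_of_nonneg hsn.le] at hinit_le
        rw [Set.mem_ofPred_eq, not_lt, norm_smul, norm_inv, Real.norm_of_nonneg hsqrt.le,
          inv_mul_le_iff₀ hsqrt, mul_comm] at hscore_le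
        exact hne (hsel _ _ _ ((le_div_iff₀' hsn).2 hinit_le) hscore_le hω)
    _ ≤ δ / 2 + δ / 2 := (measure_union_le _ _).trans (add_le_add hKinit hKscore)
    _ = δ := ENNReal.add_halves δ

end Consistency

end AdaptiveTransferLasso

theorem mainTheorem3_general
    {Ω : Type*} [MeasurableSpace Ω] (μ : Measure Ω) [IsProbabilityMeasure μ]
    (p : ℕ) (βstar : Fin p → ℝ)
    (X : (n : ℕ) → Matrix (Fin n) (Fin p) ℝ) (C : Matrix (Fin p) (Fin p) ℝ)
    (hC : C.PosDef)
    (hXC : Tendsto (fun n : ℕ => (1 / (n : ℝ)) • ((X n)ᵀ * X n)) atTop (𝓝 C))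
    (ε : (n : ℕ) → Ω → Fin n → ℝ)
    (hscore : AdaptiveTransferLasso.BoundedInProbability μ
      fun n ω => (√(n : ℝ))⁻¹ • ((X n)ᵀ *ᵥ ε n ω))
    (m : ℕ → ℕ) (hnm : (fun n : ℕ => (n : ℝ)) =O[atTop] fun n => (m n : ℝ))
    (βinit : ℕ → Ω → Fin p → ℝ)
    (hinit : AdaptiveTransferLasso.BoundedInProbability μ
      fun n ω => √(m n : ℝ) • (βinit n ω - βstar))
    (γ₁ γ₂ : ℝ) (hγ₁ : 0 ≤ γ₁) (hγ₂ : 0 ≤ γ₂)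
    (lam eta : ℕ → ℝ) (hlam : ∀ n, 0 ≤ lam n) (heta : ∀ n, 0 ≤ eta n)
    (hregime : AdaptiveTransferLasso.RootMRegime m lam eta γ₁ γ₂ ∨
      AdaptiveTransferLasso.RootNRegime m lam eta γ₁ ∨
      (0 < γ₁ ∧ AdaptiveTransferLasso.SubRootNRegime lam eta))
    (βhat : ℕ → Ω → Fin p → ℝ)
    (hβhat : ∀ᶠ n in atTop, ∀ᵐ ω ∂μ, AdaptiveTransferLasso.IsEstimate (X n)
      (X n *ᵥ βstar + ε n ω) (lam n) (eta n) γ₁ γ₂ (βinit n ω) (βhat n ω)) :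
    AdaptiveTransferLasso.ConsistentActiveSelection μ βhat βstar := by
  have hs := AdaptiveTransferLasso.tendsto_sqrt_atTop_of_isBigO hnm
  refine AdaptiveTransferLasso.consistentActiveSelection_of_eventually_selectsWithin
    (hs.eventually_gt_atTop 0) hinit hscore (fun K hK => ?_) hβhat
  rcases hregime with h | h | ⟨hγ₁_pos, h⟩
  · obtain ⟨ρ, hρ⟩ := AdaptiveTransferLasso.exists_sqrt_le_mul_sqrt hnm
    exact AdaptiveTransferLasso.eventually_selectsWithin_of_isLittleO_eta hXC hγ₁ hγ₂ hlam heta hs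
      hρ (h.isLittleO_lasso hs) h.isLittleO_eta hK
  · exact AdaptiveTransferLasso.eventually_selectsWithin_of_isLittleO_natCast hC hXC hγ₁ hγ₂ hlam
      heta hs h.isLittleO_lasso h.isLittleO_natCast hK
  · exact AdaptiveTransferLasso.eventually_selectsWithin_of_isLittleO_natCast hC hXC hγ₁ hγ₂ hlam
      heta hs (h.isLittleO_lasso hγ₁_pos hs) h.isLittleO_natCast hK

theorem mainTheorem3
    {Ω : Type*} [MeasurableSpace Ω] (μ : Measure Ω) [IsProbabilityMeasure μ]
    (p : ℕ) (βstar : Fin p → ℝ)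
    -- the design matrices and their limit
    (X : (n : ℕ) → Matrix (Fin n) (Fin p) ℝ) (C : Matrix (Fin p) (Fin p) ℝ)
    (hC : C.PosDef)
    (hXC : Tendsto (fun n : ℕ => (1 / (n : ℝ)) • ((X n)ᵀ * X n)) atTop (𝓝 C))
    (hXmax : Tendsto (fun n : ℕ => (1 / (n : ℝ)) * ⨆ i : Fin n, ∑ j, X n i j ^ 2) atTop (𝓝 0))
    -- the i.i.d. Gaussian noise
    (σ : ℝ≥0) (ε : (n : ℕ) → Ω → Fin n → ℝ)
    (hεlaw : ∀ n i, HasLaw (fun ω => ε n ω i) (gaussianReal 0 (σ ^ 2)) μ)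
    (hεindep : ∀ n, iIndepFun (fun (i : Fin n) ω => ε n ω i) μ)
    -- the source sample size and the initial estimator
    (m : ℕ → ℕ) (hm : ∀ᶠ n in atTop, 0 < m n)
    (r₀ : ℝ) (hr₀ : 0 ≤ r₀) (hnm : Tendsto (fun n : ℕ => (n : ℝ) / (m n : ℝ)) atTop (𝓝 r₀))
    (βinit : ℕ → Ω → Fin p → ℝ)
    (hindep : ∀ n, IndepFun (ε n) (βinit n) μ)
    (ν : Measure (Fin p → ℝ)) [IsProbabilityMeasure ν]
    (hz : TendstoInDistribution (fun n ω => √(m n : ℝ) • (βinit n ω - βstar)) atTop id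
      (fun _ => μ) ν)
    -- the hyperparameters
    (γ₁ γ₂ : ℝ) (hγ₁ : 0 ≤ γ₁) (hγ₂ : 0 ≤ γ₂)
    (lam eta : ℕ → ℝ) (hlam : ∀ n, 0 ≤ lam n) (heta : ∀ n, 0 ≤ eta n)
    (hregime : AdaptiveTransferLasso.RootMRegime m lam eta γ₁ γ₂ ∨
      AdaptiveTransferLasso.RootNRegime m lam eta γ₁ ∨
      (0 < γ₁ ∧ AdaptiveTransferLasso.SubRootNRegime lam eta))
    -- the Adaptive Transfer Lasso estimator for the responses `y = X β* + ε`
    (βhat : ℕ → Ω → Fin p → ℝ) (hmeas : ∀ n, AEMeasurable (βhat n) μ)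
    (hβhat : ∀ n, 0 < n → ∀ᵐ ω ∂μ, AdaptiveTransferLasso.IsEstimate (X n)
      (X n *ᵥ βstar + ε n ω) (lam n) (eta n) γ₁ γ₂ (βinit n ω) (βhat n ω)) :
    AdaptiveTransferLasso.ConsistentActiveSelection μ βhat βstar :=
  mainTheorem3_general μ p βstar X C hC hXC ε
    (AdaptiveTransferLasso.boundedInProbability_inv_sqrt_smul_transpose_mulVec_gaussian hXC hεlaw
      hεindep)
    m (isBigO_of_div_tendsto_nhds
      (hm.mono fun n hn h0 => absurd h0 (Nat.cast_ne_zero.2 hn.ne')) r₀ hnm)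
    βinit (AdaptiveTransferLasso.boundedInProbability_of_tendstoInDistribution hz)
    γ₁ γ₂ hγ₁ hγ₂ lam eta hlam heta hregime βhat ((eventually_gt_atTop 0).mono hβhat)
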